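/- Let $d\in\{1,2,3\}$, $\alpha\ge0$, $t>0$, $\beta\in(0,1]$ and $\lambda\ge e^{(3+2\alpha)/\beta}$, and put $$f_t(x)=\exp\Big(-t\,\frac{|x|^\beta}{\log^\alpha(\lambda+|x|)}\Big),\qquad x\in\mathbb R^d .$$ Then $f_t$ is positive definite on $\mathbb R^d$: for all $n\ge1$, all $x_1,\dots,x_n\in\mathbb R^d$ and all $c_1,\dots,c_n\in\mathbb C$, the number $\sum_{j,k=1}^n f_t(x_j-x_k)\,c_j\overline{c_k}$ is real and nonnegative. Consequently the heat kernel of the operator $|\mathrm D|^\beta/\log^\alpha(\lambda+|\mathrm D|)$, $$K_t(x)=(2\pi)^{-d}\int_{\mathbb R^d}f_t(\xi)\,e^{i x\cdot\xi}\,d\xi ,$$ is a probability density: $K_t$ is integrable, continuous and vanishes at infinity; its Fourier transform is $\widehat{K_t}(\xi)=\int_{\mathbb R^d}e^{-ix\cdot\xi}K_t(x)\,dx=f_t(\xi)$ for all $\xi\in\mathbb R^d$; $K_t(x)$ is real and $K_t(x)\ge0$ for all $x\in\mathbb R^d$; and $\|K_t\|_{L^1}=\int_{\mathbb R^d}K_t(x)\,dx=1$.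 -/

import Mathlib

open scoped ComplexOrder

/-- A function `f` on `ℝ^d` is positive definite if every matrix `(f (x_j - x_k))_{j,k}` is positive
semidefinite. The order on `ℂ` is the usual partial one: `0 ≤ z` says that `z` is real and
nonnegative. -/
def IsPositiveDefiniteFun {d : ℕ} (f : EuclideanSpace ℝ (Fin d) → ℂ) : Prop :=
  ∀ (n : ℕ) (x : Fin n → EuclideanSpace ℝ (Fin d)) (c : Fin n → ℂ),
    0 ≤ ∑ j, ∑ k, f (x j - x k) * c j * (starRingEnd ℂ) (c k)

/-- The Fourier symbol `exp (-t |ξ|^β / log^α (lam + |ξ|))` of the semigroup generated by (minus)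
the logarithmic operator `|D|^β / log^α (lam + |D|)`. -/
noncomputable def logHeatSymbol (d : ℕ) (α β lam t : ℝ) (ξ : EuclideanSpace ℝ (Fin d)) : ℝ :=
  Real.exp (-t * (‖ξ‖ ^ β / Real.log (lam + ‖ξ‖) ^ α))

/-- The Fourier transform `∫ e^{-i x·ξ} g x dx` (without a factor `2π` in the exponent). -/
noncomputable def fourierTransform {d : ℕ} (g : EuclideanSpace ℝ (Fin d) → ℂ)
    (ξ : EuclideanSpace ℝ (Fin d)) : ℂ :=
  ∫ x, Complex.exp (-Complex.I * (inner ℝ x ξ : ℝ)) * g x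

/-- The heat kernel `K_t`: the inverse Fourier transform
`(2π)^{-d} ∫ exp (-t |ξ|^β / log^α (lam + |ξ|)) e^{i x·ξ} dξ` of the symbol. -/
noncomputable def logHeatKernel (d : ℕ) (α β lam t : ℝ) (x : EuclideanSpace ℝ (Fin d)) : ℂ :=
  ((2 * Real.pi : ℝ) : ℂ)⁻¹ ^ d *
    ∫ ξ, (logHeatSymbol d α β lam t ξ : ℂ) * Complex.exp (Complex.I * (inner ℝ x ξ : ℝ))

open MeasureTheory Filter Topology Set
open scoped FourierTransform

/-! The symbol is `F ‖ξ‖` with `F = exp (-t ψ)` and `ψ r = r ^ β / log (lam + r) ^ α`. Positive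
definiteness comes from a criterion in dimension three that uses few derivatives: it suffices that
`F` decreases to zero, `F'' ≥ 0` and `F'' r / r` is decreasing. Such an `F` is a mixture of overlap
volumes of equal balls: for the decreasing density `h s = F'' (2 s) / (π s)`, the integral of `min
(h ‖p - z‖) (h ‖q - z‖)` over `z` in `ℝ³` equals `F ‖p - q‖` (`IsHatProfile.lintegral_min`). It is
also the volume of the intersection of the regions under the two graphs, so `F ‖p - q‖` is an inner
product of indicator functions in `L²` (`IsHatProfile.exists_inner_eq`). Dimensions one and two
embed isometrically in `ℝ³`.

For `F = exp (-t ψ)` one has `F'' / r = F (t² ψ'² / r + t (-ψ'' / r))`. This is nonnegative and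
decreasing once `ψ'` and `-ψ'' / r` are; the latter is where the size of `lam` matters
(`logPowFactor₂_deriv_nonpos`).

The kernel statements use the easy half of Bochner's theorem. Gaussian averages of the Gram kernel
are squared norms, so `𝓕 f ≥ 0` (`fourier_nonneg_of_inner_eq`). A nonnegative transform of a
continuous integrable function is integrable (`integrable_fourier_of_nonneg`). Fourier inversion
then applies, and its value at zero gives total mass one. -/

/-! ### Derivatives of the exponent `ψ`. -/

/-- The correction `α r / ((lam + r) log (lam + r))` to the logarithmic derivative of
`r ^ γ / log (lam + r) ^ α`. -/
noncomputable def logSlope (α lam r : ℝ) : ℝ := α * (r / (lam + r)) * (Real.log (lam + r))⁻¹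

/-- The logarithmic derivative of `r ↦ logSlope α lam r`, multiplied by `r`. -/
noncomputable def logSlopeRate (lam r : ℝ) : ℝ :=
  1 - r / (lam + r) - r / (lam + r) * (Real.log (lam + r))⁻¹

lemma hasDerivAt_ratio {lam r : ℝ} (hr : 0 < r) (hlam : 0 < lam) :
    HasDerivAt (fun r => r / (lam + r)) (r / (lam + r) * (1 - r / (lam + r)) / r) r := by
  have h := (hasDerivAt_id r).div ((hasDerivAt_id r).const_add lam) (by simp; positivity)
  refine h.congr_deriv ?_
  have : lam + r ≠ 0 := by positivity
  simp only [id]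
  field_simp

lemma hasDerivAt_inv_log {lam r : ℝ} (hr : 0 < r) (hlam : 1 < lam) :
    HasDerivAt (fun r => (Real.log (lam + r))⁻¹)
      (-(r / (lam + r) * (Real.log (lam + r))⁻¹ ^ 2) / r) r := by
  have hL : 0 < Real.log (lam + r) := Real.log_pos (by linarith)
  have h0 : lam + r ≠ 0 := by positivity
  have h := (((hasDerivAt_id r).const_add lam).log (by simpa using h0)).inv
    (by simpa using hL.ne')
  refine h.congr_deriv ?_
  simp only [id]
  field_simp

lemma hasDerivAt_logSlope (α : ℝ) {lam r : ℝ} (hr : 0 < r) (hlam : 1 < lam) :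
    HasDerivAt (logSlope α lam) (logSlope α lam r * logSlopeRate lam r / r) r := by
  have h := ((hasDerivAt_ratio hr (by linarith : (0 : ℝ) < lam)).const_mul α).mul
    (hasDerivAt_inv_log hr hlam)
  refine h.congr_deriv ?_
  simp only [logSlope, logSlopeRate]
  ring

lemma hasDerivAt_logSlopeRate {lam r : ℝ} (hr : 0 < r) (hlam : 1 < lam) :
    HasDerivAt (logSlopeRate lam)
      ((-(r / (lam + r) * (1 - r / (lam + r)) * (1 + (Real.log (lam + r))⁻¹))
        + (r / (lam + r)) ^ 2 * (Real.log (lam + r))⁻¹ ^ 2) / r) r := by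
  have hq := hasDerivAt_ratio hr (by linarith : (0 : ℝ) < lam)
  have h := (hq.const_sub 1).sub (hq.mul (hasDerivAt_inv_log hr hlam))
  refine h.congr_deriv ?_
  ring

/-- The shape `r ^ γ L ^ (-α) P` is stable under differentiation: `γ` drops by one and only `P`
changes. Using it with `γ = β`, `β - 1` and `β - 3` reduces every sign question about `ψ`, `ψ'` and
`-ψ'' / r` to one about a bounded factor. -/
lemma hasDerivAt_rpow_mul_log_rpow_mul (γ α : ℝ) {lam r P' : ℝ} {P : ℝ → ℝ} (hr : 0 < r)
    (hlam : 1 < lam) (hP : HasDerivAt P P' r) :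
    HasDerivAt (fun r => r ^ γ * Real.log (lam + r) ^ (-α) * P r)
      (r ^ (γ - 1) * Real.log (lam + r) ^ (-α) * ((γ - logSlope α lam r) * P r + r * P')) r := by
  have hL : 0 < Real.log (lam + r) := Real.log_pos (by linarith)
  have h0 : lam + r ≠ 0 := by positivity
  have h1 := (hasDerivAt_id r).rpow_const (p := γ) (Or.inl hr.ne')
  have h2 := (((hasDerivAt_id r).const_add lam).log (by simpa using h0)).rpow_const (p := -α)
    (Or.inl (by simpa using hL.ne'))
  refine ((h1.mul h2).mul hP).congr_deriv ?_
  simp only [id, Pi.mul_apply, logSlope]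
  rw [Real.rpow_sub_one hr.ne', Real.rpow_sub_one hL.ne']
  field_simp
  ring

/-- The factor `A` in `(r ^ β / L ^ α)' = r ^ (β - 1) L ^ (-α) A`, where `L = log (lam + r)`. -/
noncomputable def logPowFactor (β α lam r : ℝ) : ℝ := β - logSlope α lam r

/-- The factor `B` in `(r ^ β / L ^ α)'' = - r ^ (β - 2) L ^ (-α) B`, where `L = log (lam + r)`. -/
noncomputable def logPowFactor₂ (β α lam r : ℝ) : ℝ :=
  logPowFactor β α lam r * (1 - logPowFactor β α lam r) + logSlope α lam r * logSlopeRate lam r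

/-- The first derivative of `r ^ β / log (lam + r) ^ α`. -/
noncomputable def logPowDeriv (β α lam r : ℝ) : ℝ :=
  r ^ (β - 1) * Real.log (lam + r) ^ (-α) * logPowFactor β α lam r

/-- `-ψ'' / r` for `ψ = r ^ β / log (lam + r) ^ α`. -/
noncomputable def logPowNegDeriv₂Div (β α lam r : ℝ) : ℝ :=
  r ^ (β - 3) * Real.log (lam + r) ^ (-α) * logPowFactor₂ β α lam r

lemma hasDerivAt_logPow (β α : ℝ) {lam r : ℝ} (hr : 0 < r) (hlam : 1 < lam) :
    HasDerivAt (fun r => r ^ β / Real.log (lam + r) ^ α) (logPowDeriv β α lam r) r := by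
  have h := hasDerivAt_rpow_mul_log_rpow_mul β α hr hlam (hasDerivAt_const r (1 : ℝ))
  refine (h.congr_deriv ?_).congr_of_eventuallyEq ?_
  · simp [logPowDeriv, logPowFactor]
  · filter_upwards [lt_mem_nhds hr] with s hs
    rw [Real.rpow_neg (Real.log_nonneg (by linarith)), mul_one, div_eq_mul_inv]

lemma hasDerivAt_logPowDeriv (β α : ℝ) {lam r : ℝ} (hr : 0 < r) (hlam : 1 < lam) :
    HasDerivAt (logPowDeriv β α lam) (-(r * logPowNegDeriv₂Div β α lam r)) r := by
  have h := hasDerivAt_rpow_mul_log_rpow_mul (β - 1) α hr hlam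
    ((hasDerivAt_logSlope α hr hlam).const_sub β)
  refine h.congr_deriv ?_
  simp only [logPowNegDeriv₂Div, logPowFactor₂, logPowFactor]
  rw [show β - 1 - 1 = β - 3 + 1 by ring, Real.rpow_add_one hr.ne']
  field_simp
  ring

/-! ### Signs and monotonicity of `ψ'` and `-ψ'' / r`. -/

section Estimates

variable {β α lam : ℝ}

lemma one_lt_of_exp_le (hα : 0 ≤ α) (hβ : 0 < β) (hlam : Real.exp ((3 + 2 * α) / β) ≤ lam) :
    1 < lam :=
  (Real.one_lt_exp_iff.2 (by positivity)).trans_le hlam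

/-- Apart from `1 < lam`, this is the only form in which the lower bound on `lam` enters the
estimates. -/
lemma inv_log_mul_le (hα : 0 ≤ α) (hβ : 0 < β) (hlam : Real.exp ((3 + 2 * α) / β) ≤ lam) {r : ℝ}
    (hr : 0 < r) : (Real.log (lam + r))⁻¹ * (3 + 2 * α) ≤ β := by
  have h : (3 + 2 * α) / β ≤ Real.log (lam + r) := by
    rw [Real.le_log_iff_exp_le (by linarith [one_lt_of_exp_le hα hβ hlam])]
    linarith
  have h0 : 0 < (3 + 2 * α) / β := by positivity
  rw [inv_mul_le_iff₀ (h0.trans_le h)]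
  rw [div_le_iff₀ hβ] at h
  linarith

lemma inv_log_pos (hlam : 1 < lam) {r : ℝ} (hr : 0 < r) : 0 < (Real.log (lam + r))⁻¹ :=
  inv_pos.2 (Real.log_pos (by linarith))

lemma ratio_mem (hlam : 1 < lam) {r : ℝ} (hr : 0 < r) :
    0 ≤ r / (lam + r) ∧ r / (lam + r) ≤ 1 :=
  ⟨by positivity, (div_le_one (by positivity)).2 (by linarith)⟩

lemma logPowFactor_nonneg (hα : 0 ≤ α) (hβ : 0 < β) (hlam : Real.exp ((3 + 2 * α) / β) ≤ lam)
    {r : ℝ} (hr : 0 < r) : 0 ≤ logPowFactor β α lam r := by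
  have h1 := one_lt_of_exp_le hα hβ hlam
  have hl := inv_log_mul_le hα hβ hlam hr
  have hl0 := inv_log_pos h1 hr
  obtain ⟨hq0, hq1⟩ := ratio_mem h1 hr
  simp only [logPowFactor, logSlope]
  generalize r / (lam + r) = q at *
  generalize (Real.log (lam + r))⁻¹ = l at *
  nlinarith [mul_le_mul_of_nonneg_right hq1 (mul_nonneg hα hl0.le), mul_nonneg hα hl0.le]

lemma logPowFactor₂_nonneg (hα : 0 ≤ α) (hβ : 0 < β) (hβ' : β ≤ 1)
    (hlam : Real.exp ((3 + 2 * α) / β) ≤ lam) {r : ℝ} (hr : 0 < r) :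
    0 ≤ logPowFactor₂ β α lam r := by
  have h1 := one_lt_of_exp_le hα hβ hlam
  have hl := inv_log_mul_le hα hβ hlam hr
  have hl0 := inv_log_pos h1 hr
  obtain ⟨hq0, hq1⟩ := ratio_mem h1 hr
  have hA := logPowFactor_nonneg hα hβ hlam hr
  simp only [logPowFactor₂, logPowFactor, logSlopeRate, logSlope] at *
  generalize r / (lam + r) = q at *
  generalize (Real.log (lam + r))⁻¹ = l at *
  have hp : 0 ≤ α * q * l := by positivity
  have hql : q * l ≤ l := by nlinarith
  have hpl : α * q * l ≤ α * l := by nlinarith [mul_le_mul_of_nonneg_left hql hα]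
  have h2 : 0 ≤ β - α * q * l - q * l := by nlinarith [mul_nonneg hα hl0.le]
  -- With `p = α q l` and `A = β - p`, the factor equals `A (1 - β) + p (1 - q) + p (β - p - q l)`,
  -- a sum of nonnegative terms.
  nlinarith [mul_nonneg hp h2, mul_nonneg hp (sub_nonneg.2 hq1),
    mul_nonneg hA (sub_nonneg.2 hβ')]

/-- The expression bounded here is the sign-carrying factor of the derivative of `-ψ'' / r`, hence
of a third derivative of `ψ`. -/
lemma logPowFactor₂_deriv_nonpos (hα : 0 ≤ α) (hβ : 0 < β) (hβ' : β ≤ 1)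
    (hlam : Real.exp ((3 + 2 * α) / β) ≤ lam) {r : ℝ} (hr : 0 < r) :
    ∃ B', HasDerivAt (logPowFactor₂ β α lam) B' r ∧
      (β - 3 - logSlope α lam r) * logPowFactor₂ β α lam r + r * B' ≤ 0 := by
  have h1 := one_lt_of_exp_le hα hβ hlam
  have hl := inv_log_mul_le hα hβ hlam hr
  have hl0 := inv_log_pos h1 hr
  obtain ⟨hq0, hq1⟩ := ratio_mem h1 hr
  have hA := logPowFactor_nonneg hα hβ hlam hr
  have dp := hasDerivAt_logSlope α hr h1
  have de := hasDerivAt_logSlopeRate hr h1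
  have dA : HasDerivAt (logPowFactor β α lam) _ r := dp.const_sub β
  refine ⟨_, (dA.mul (dA.const_sub 1)).add (dp.mul de), ?_⟩
  have hp : 0 ≤ logSlope α lam r := by simp only [logSlope]; positivity
  have hpl : logSlope α lam r ≤ α * (Real.log (lam + r))⁻¹ := by
    simp only [logSlope]
    nlinarith [mul_nonneg hα hl0.le]
  have he1 : logSlopeRate lam r ≤ 1 := by
    simp only [logSlopeRate]; nlinarith [mul_nonneg hq0 hl0.le]
  have he0 : -(Real.log (lam + r))⁻¹ ≤ logSlopeRate lam r := by
    simp only [logSlopeRate]; nlinarith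
  simp only [logPowFactor₂, logPowFactor] at *
  generalize logSlope α lam r = p at *
  generalize logSlopeRate lam r = e at *
  generalize r / (lam + r) = q at *
  generalize (Real.log (lam + r))⁻¹ = l at *
  have hl1 : l ≤ 1 / 3 := by nlinarith [mul_nonneg hα hl0.le]
  set A := β - p with hAdef
  set e' := -(q * (1 - q) * (1 + l)) + q ^ 2 * l ^ 2 with he'
  -- The constant `3` in the threshold gives `3 l ≤ A ≤ 1`, so the main term is at least `2 A ≥ 6
  -- l`. The other two terms lose at most `4 l + l ^ 2` and `l`, and `l ≤ 1 / 3`.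
  have key : 0 ≤ (3 - A) * A + e * (4 - 3 * A - e) - e' := by
    have hA1 : A ≤ 1 := by linarith
    have hAl : 3 * l ≤ A := by nlinarith [mul_nonneg hα hl0.le]
    have h4 : e' ≤ l := by
      have : 0 ≤ q * (1 - q) * (1 + l) := by
        have := sub_nonneg.2 hq1
        positivity
      have : q ^ 2 * l ^ 2 ≤ l ^ 2 := by
        have : q ^ 2 ≤ 1 := by nlinarith
        nlinarith [sq_nonneg l]
      nlinarith
    have h5 : 2 * A ≤ (3 - A) * A := by nlinarith
    have h6 : -(l * (4 + l)) ≤ e * (4 - 3 * A - e) := by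
      rcases le_total 0 e with h | h
      · have : 0 ≤ e * (4 - 3 * A - e) := mul_nonneg h (by linarith)
        nlinarith
      · nlinarith [mul_nonneg (by linarith : 0 ≤ l + e) (by linarith : 0 ≤ 4 - 3 * A - e),
          mul_nonneg hl0.le (by linarith : 0 ≤ 3 * A + e + l)]
    nlinarith
  have h1A : p ≤ 1 - A := by linarith
  have hr' := hr.ne'
  -- Here `1 - A - p = 1 - β ≥ 0`, so both summands inside the negated bracket are nonnegative.
  have : (β - 3 - p) * (A * (1 - A) + p * e) +
      r * (-(p * e / r) * (1 - A) + A * -(-(p * e / r)) + (p * e / r * e + p * (e' / r))) =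
      -((3 - A) * A * (1 - A - p) + p * ((3 - A) * A + e * (4 - 3 * A - e) - e')) := by
    rw [hAdef]
    field_simp
    ring
  refine this.le.trans ?_
  have := mul_nonneg hp key
  have := mul_nonneg (mul_nonneg (by linarith : 0 ≤ 3 - A) hA) (sub_nonneg.2 h1A)
  linarith

lemma log_rpow_neg_nonneg (hlam : 1 < lam) {r : ℝ} (hr : 0 < r) (α : ℝ) :
    0 ≤ Real.log (lam + r) ^ (-α) :=
  Real.rpow_nonneg (Real.log_nonneg (by linarith)) _

lemma logPowDeriv_nonneg (hα : 0 ≤ α) (hβ : 0 < β)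
    (hlam : Real.exp ((3 + 2 * α) / β) ≤ lam) {r : ℝ} (hr : 0 < r) :
    0 ≤ logPowDeriv β α lam r :=
  mul_nonneg (mul_nonneg (by positivity)
    (log_rpow_neg_nonneg (one_lt_of_exp_le hα hβ hlam) hr α)) (logPowFactor_nonneg hα hβ hlam hr)

lemma logPowNegDeriv₂Div_nonneg (hα : 0 ≤ α) (hβ : 0 < β) (hβ' : β ≤ 1)
    (hlam : Real.exp ((3 + 2 * α) / β) ≤ lam) {r : ℝ} (hr : 0 < r) :
    0 ≤ logPowNegDeriv₂Div β α lam r :=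
  mul_nonneg (mul_nonneg (by positivity)
    (log_rpow_neg_nonneg (one_lt_of_exp_le hα hβ hlam) hr α))
    (logPowFactor₂_nonneg hα hβ hβ' hlam hr)

lemma antitoneOn_Ioi_of_hasDerivAt_nonpos {f f' : ℝ → ℝ}
    (hf : ∀ r ∈ Ioi (0 : ℝ), HasDerivAt f (f' r) r) (hf' : ∀ r ∈ Ioi (0 : ℝ), f' r ≤ 0) :
    AntitoneOn f (Ioi 0) := by
  refine antitoneOn_of_deriv_nonpos (convex_Ioi 0)
    (fun r hr => (hf r hr).continuousAt.continuousWithinAt) ?_ ?_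
  · rw [interior_Ioi]
    exact fun r hr => (hf r hr).differentiableAt.differentiableWithinAt
  · rw [interior_Ioi]
    intro r hr
    rw [(hf r hr).deriv]
    exact hf' r hr

lemma logPowDeriv_antitoneOn (hα : 0 ≤ α) (hβ : 0 < β) (hβ' : β ≤ 1)
    (hlam : Real.exp ((3 + 2 * α) / β) ≤ lam) :
    AntitoneOn (logPowDeriv β α lam) (Ioi 0) :=
  antitoneOn_Ioi_of_hasDerivAt_nonpos
    (fun _ hr => hasDerivAt_logPowDeriv β α hr (one_lt_of_exp_le hα hβ hlam))
    (fun _ hr => neg_nonpos.2 (mul_nonneg (le_of_lt hr)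
      (logPowNegDeriv₂Div_nonneg hα hβ hβ' hlam hr)))

lemma logPowNegDeriv₂Div_antitoneOn (hα : 0 ≤ α) (hβ : 0 < β) (hβ' : β ≤ 1)
    (hlam : Real.exp ((3 + 2 * α) / β) ≤ lam) :
    AntitoneOn (logPowNegDeriv₂Div β α lam) (Ioi 0) := by
  have h1 := one_lt_of_exp_le hα hβ hlam
  have (r : ℝ) : ∃ f', r ∈ Ioi (0 : ℝ) →
      HasDerivAt (logPowNegDeriv₂Div β α lam) f' r ∧ f' ≤ 0 := by
    by_cases hr : r ∈ Ioi (0 : ℝ)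
    · obtain ⟨B', hB, hB'⟩ := logPowFactor₂_deriv_nonpos hα hβ hβ' hlam hr
      rw [mem_Ioi] at hr
      exact ⟨_, fun _ => ⟨hasDerivAt_rpow_mul_log_rpow_mul (β - 3) α hr h1 hB,
        mul_nonpos_of_nonneg_of_nonpos
          (mul_nonneg (by positivity) (log_rpow_neg_nonneg h1 hr α)) hB'⟩⟩
    · exact ⟨0, fun h => absurd h hr⟩
  choose f' hf' using this
  exact antitoneOn_Ioi_of_hasDerivAt_nonpos (fun r hr => (hf' r hr).1) (fun r hr => (hf' r hr).2)

end Estimates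

/-! ### Radial profiles on `ℝ³` as overlap volumes. -/

/-- A radial profile `F` on `[0, ∞)`, with first and second derivatives `F₁` and `F₂`, such that
`F` is decreasing and convex, vanishes at infinity, and `F₂ r / r` is decreasing. -/
structure IsHatProfile (F F₁ F₂ : ℝ → ℝ) : Prop where
  -- Only continuity is asked at the origin: for the heat profile with `β < 1` the derivative is
  -- unbounded there.
  continuousWithinAt_zero : ContinuousWithinAt F (Ici 0) 0
  hasDerivAt : ∀ r ∈ Ioi (0 : ℝ), HasDerivAt F (F₁ r) r
  hasDerivAt_deriv : ∀ r ∈ Ioi (0 : ℝ), HasDerivAt F₁ (F₂ r) r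
  deriv_nonpos : ∀ r ∈ Ioi (0 : ℝ), F₁ r ≤ 0
  measurable_deriv₂ : Measurable F₂
  deriv₂_nonneg : ∀ r ∈ Ioi (0 : ℝ), 0 ≤ F₂ r
  antitoneOn : AntitoneOn (fun r => F₂ r / r) (Ioi 0)
  tendsto : Tendsto F atTop (𝓝 0)
  tendsto_deriv : Tendsto F₁ atTop (𝓝 0)

/-- The density `s ↦ F'' (2 s) / (π s)`. The kernel `F ‖p - q‖` on `ℝ³` is the integral over `z` of
the values of this density at the larger of the distances of `z` to `p` and `q`. -/
noncomputable def hatDensity (F₂ : ℝ → ℝ) (s : ℝ) : ℝ := F₂ (2 * s) / (Real.pi * s)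

namespace IsHatProfile

variable {F F₁ F₂ : ℝ → ℝ} (h : IsHatProfile F F₁ F₂)
include h

lemma measurable_hatDensity : Measurable (hatDensity F₂) :=
  (h.measurable_deriv₂.comp (measurable_const_mul 2)).div (measurable_const_mul Real.pi)

lemma hatDensity_nonneg {s : ℝ} (hs : 0 ≤ s) : 0 ≤ hatDensity F₂ s := by
  rcases hs.eq_or_lt with rfl | hs
  · simp [hatDensity]
  · exact div_nonneg (h.deriv₂_nonneg _ (by simpa using hs)) (by positivity)

lemma hatDensity_antitoneOn : AntitoneOn (hatDensity F₂) (Ioi 0) := by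
  intro a ha b hb hab
  rw [mem_Ioi] at ha hb
  have := h.antitoneOn (show 2 * a ∈ Ioi (0 : ℝ) by simpa using ha)
    (show 2 * b ∈ Ioi (0 : ℝ) by simpa using hb) (by linarith)
  have e (s : ℝ) (hs : 0 < s) : hatDensity F₂ s = 2 / Real.pi * (F₂ (2 * s) / (2 * s)) := by
    have := Real.pi_pos.ne'
    simp only [hatDensity]
    field_simp
  rw [e a ha, e b hb]
  exact mul_le_mul_of_nonneg_left this (by positivity)

/-- The density is chosen so that the integrand is exactly the `r`-derivative of `F₁ (2 √(u² + r²))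
/ (2 π)`, which vanishes at infinity. Polar coordinates then supply the factor `2 π` in
`lintegral_plane`. -/
lemma lintegral_radial {u : ℝ} (hu : 0 < u) :
    ∫⁻ r in Ioi (0 : ℝ), ENNReal.ofReal (r * hatDensity F₂ (√(u ^ 2 + r ^ 2))) =
      ENNReal.ofReal (-F₁ (2 * u) / (2 * Real.pi)) := by
  have hsq (r : ℝ) : 0 < u ^ 2 + r ^ 2 := by positivity
  have hd : ∀ r : ℝ, HasDerivAt (fun r => F₁ (2 * √(u ^ 2 + r ^ 2)) / (2 * Real.pi))
      (r * hatDensity F₂ (√(u ^ 2 + r ^ 2))) r := by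
    intro r
    have h1 := ((((hasDerivAt_id r).pow 2).const_add (u ^ 2)).sqrt (hsq r).ne').const_mul 2
    have hs : 0 < √(u ^ 2 + r ^ 2) := Real.sqrt_pos.2 (hsq r)
    have h2 := (HasDerivAt.comp r (h.hasDerivAt_deriv (2 * √(u ^ 2 + r ^ 2))
      (by simpa using hs)) h1).div_const (2 * Real.pi)
    refine h2.congr_deriv ?_
    have := Real.pi_pos.ne'
    simp only [hatDensity, id, Pi.pow_apply]
    field_simp
    simp
    ring
  have hpos : ∀ r ∈ Ioi (0 : ℝ), 0 ≤ r * hatDensity F₂ (√(u ^ 2 + r ^ 2)) := fun r hr =>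
    mul_nonneg (le_of_lt hr) (h.hatDensity_nonneg (Real.sqrt_nonneg _))
  have hlim : Tendsto (fun r => F₁ (2 * √(u ^ 2 + r ^ 2)) / (2 * Real.pi)) atTop (𝓝 0) := by
    have : Tendsto (fun r : ℝ => 2 * √(u ^ 2 + r ^ 2)) atTop atTop := by
      refine tendsto_atTop_mono' _ ?_ tendsto_id
      filter_upwards [eventually_ge_atTop 0] with r hr
      have : r ≤ √(u ^ 2 + r ^ 2) := Real.le_sqrt_of_sq_le (by nlinarith)
      simp only [id]
      linarith
    simpa using (h.tendsto_deriv.comp this).div_const (2 * Real.pi)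
  have hc := (hd 0).continuousAt.continuousWithinAt (s := Ici 0)
  rw [← ofReal_integral_eq_lintegral_ofReal
    (integrableOn_Ioi_deriv_of_nonneg hc (fun r _ => hd r) hpos hlim)
    ((ae_restrict_iff' measurableSet_Ioi).2 (ae_of_all _ hpos)),
    integral_Ioi_of_hasDerivAt_of_nonneg hc (fun r _ => hd r) hpos hlim]
  congr 1
  simp [Real.sqrt_sq hu.le]
  ring

lemma lintegral_plane {u : ℝ} (hu : 0 < u) :
    ∫⁻ w : ℝ × ℝ, ENNReal.ofReal (hatDensity F₂ (√(u ^ 2 + w.1 ^ 2 + w.2 ^ 2))) =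
      ENNReal.ofReal (-F₁ (2 * u)) := by
  have hm := h.measurable_hatDensity
  rw [← lintegral_comp_polarCoord_symm]
  have e (p : ℝ × ℝ) : u ^ 2 + (p.1 * Real.cos p.2) ^ 2 + (p.1 * Real.sin p.2) ^ 2 =
      u ^ 2 + p.1 ^ 2 := by
    linear_combination p.1 ^ 2 * Real.sin_sq_add_cos_sq p.2
  simp only [polarCoord_symm_apply, polarCoord_target, smul_eq_mul, e]
  rw [Measure.volume_eq_prod, ← Measure.prod_restrict, lintegral_prod _ (by fun_prop)]
  simp only [lintegral_const, Measure.restrict_apply MeasurableSet.univ, univ_inter,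
    Real.volume_Ioo]
  rw [lintegral_mul_const _ (by fun_prop)]
  have : ∫⁻ r in Ioi (0 : ℝ), ENNReal.ofReal r *
      ENNReal.ofReal (hatDensity F₂ (√(u ^ 2 + r ^ 2))) =
      ∫⁻ r in Ioi (0 : ℝ), ENNReal.ofReal (r * hatDensity F₂ (√(u ^ 2 + r ^ 2))) :=
    setLIntegral_congr_fun measurableSet_Ioi fun r hr => (ENNReal.ofReal_mul (le_of_lt hr)).symm
  have hF : F₁ (2 * u) ≤ 0 := h.deriv_nonpos _ (by simpa using hu)
  rw [this, h.lintegral_radial hu, ← ENNReal.ofReal_mul (by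
    have := Real.pi_pos; exact div_nonneg (by linarith) (by linarith))]
  congr 1
  have := Real.pi_pos.ne'
  field_simp
  ring

lemma lintegral_line {u : ℝ} (hu : 0 ≤ u) :
    ∫⁻ s : ℝ, ENNReal.ofReal (-F₁ (2 * (|s| + u))) = ENNReal.ofReal (F (2 * u)) := by
  have hd : ∀ s ∈ Ioi (0 : ℝ), HasDerivAt (fun s => -F (2 * (s + u)) / 2) (-F₁ (2 * (s + u))) s := by
    intro s hs
    rw [mem_Ioi] at hs
    have h1 := ((hasDerivAt_id s).add_const u).const_mul 2
    have h2 := ((HasDerivAt.comp s (h.hasDerivAt (2 * (s + u))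
      (by rw [mem_Ioi]; positivity)) h1).neg).div_const 2
    refine h2.congr_deriv ?_
    ring
  have hpos : ∀ s ∈ Ioi (0 : ℝ), 0 ≤ -F₁ (2 * (s + u)) := fun s hs =>
    neg_nonneg.2 (h.deriv_nonpos _ (by rw [mem_Ioi] at *; positivity))
  have hlim : Tendsto (fun s => -F (2 * (s + u)) / 2) atTop (𝓝 0) := by
    have : Tendsto (fun s : ℝ => 2 * (s + u)) atTop atTop :=
      (tendsto_atTop_add_const_right _ _ tendsto_id).const_mul_atTop two_pos
    simpa using (h.tendsto.comp this).neg.div_const 2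
  have hc : ContinuousWithinAt (fun s => -F (2 * (s + u)) / 2) (Ici 0) 0 := by
    have : ContinuousWithinAt F (Ici 0) (2 * (0 + u)) := by
      rcases hu.eq_or_lt with rfl | hu
      · simpa using h.continuousWithinAt_zero
      · exact (h.hasDerivAt _ (by simpa using hu)).continuousAt.continuousWithinAt
    refine ((this.comp (f := fun s : ℝ => 2 * (s + u)) (s := Ici 0)
      (by fun_prop) ?_).neg).div_const 2
    intro s hs
    rw [mem_Ici] at *
    positivity
  have hI := integrableOn_Ioi_deriv_of_nonneg hc hd hpos hlim
  have key : ∫⁻ s in Ioi (0 : ℝ), ENNReal.ofReal (-F₁ (2 * (|s| + u))) =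
      ENNReal.ofReal (F (2 * u) / 2) := by
    rw [setLIntegral_congr_fun (g := fun s => ENNReal.ofReal (-F₁ (2 * (s + u)))) measurableSet_Ioi
      (fun s hs => by simp only [abs_of_pos (mem_Ioi.1 hs)]),
      ← ofReal_integral_eq_lintegral_ofReal hI
        ((ae_restrict_iff' measurableSet_Ioi).2 (ae_of_all _ hpos)),
      integral_Ioi_of_hasDerivAt_of_nonneg hc hd hpos hlim]
    congr 1
    simp
    ring
  have key' : ∫⁻ s in Iic (0 : ℝ), ENNReal.ofReal (-F₁ (2 * (|s| + u))) =
      ENNReal.ofReal (F (2 * u) / 2) := by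
    rw [← key, ← (Measure.measurePreserving_neg (volume : Measure ℝ)).setLIntegral_comp_preimage_emb
      (MeasurableEquiv.neg ℝ).measurableEmbedding _ (Iic 0)]
    simp only [abs_neg, neg_preimage, neg_Iic, neg_zero]
    exact setLIntegral_congr Ioi_ae_eq_Ici.symm
  have hF : 0 ≤ F (2 * u) / 2 := by
    have := integral_Ioi_of_hasDerivAt_of_nonneg hc hd hpos hlim
    have h0 := setIntegral_nonneg (μ := volume) measurableSet_Ioi hpos
    rw [this] at h0
    simp at h0
    linarith
  rw [← lintegral_add_compl _ (measurableSet_Ioi (a := (0 : ℝ))), compl_Ioi, key, key',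
    ← ENNReal.ofReal_add hF hF]
  ring_nf

end IsHatProfile

/-- Measure preserving coordinates `(s, w) ∈ ℝ × ℝ²` on Euclidean space of dimension three, centred
at the midpoint of `p` and `q`, with first axis in the direction of `p - q`. -/
lemma exists_measurePreserving_bipolar (p q : EuclideanSpace ℝ (Fin 3)) :
    ∃ T : ℝ × ℝ × ℝ → EuclideanSpace ℝ (Fin 3), MeasurePreserving T ∧
      (∀ s w, dist p (T (s, w)) = √((s - dist p q / 2) ^ 2 + w.1 ^ 2 + w.2 ^ 2)) ∧
      ∀ s w, dist q (T (s, w)) = √((s + dist p q / 2) ^ 2 + w.1 ^ 2 + w.2 ^ 2) := by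
  obtain ⟨b, hb⟩ : ∃ b : OrthonormalBasis (Fin 3) ℝ (EuclideanSpace ℝ (Fin 3)),
      p - q = dist p q • b 0 := by
    rcases eq_or_ne p q with rfl | hpq
    · exact ⟨EuclideanSpace.basisFun _ ℝ, by simp⟩
    · have hd : dist p q ≠ 0 := dist_ne_zero.2 hpq
      obtain ⟨b, hb⟩ := Orthonormal.exists_orthonormalBasis_extension_of_card_eq
        (𝕜 := ℝ) (E := EuclideanSpace ℝ (Fin 3)) (ι := Fin 3) (by simp)
        (v := fun _ => (dist p q)⁻¹ • (p - q)) (s := {0}) (by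
          rw [orthonormal_iff_ite]
          rintro ⟨i, rfl⟩ ⟨j, rfl⟩
          simp only [Set.domRestrict_apply, if_true, real_inner_self_eq_norm_sq, norm_smul,
            ← dist_eq_norm]
          simp [hd])
      exact ⟨b, by rw [hb 0 rfl, smul_smul, mul_inv_cancel₀ hd, one_smul]⟩
  have hT : MeasurePreserving (fun x : ℝ × ℝ × ℝ =>
      (2⁻¹ : ℝ) • (p + q) + b.repr.symm (WithLp.toLp 2 ![x.1, x.2.1, x.2.2])) := by
    refine (measurePreserving_add_left volume _).comp (b.measurePreserving_repr_symm.comp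
      ((PiLp.volume_preserving_toLp (Fin 3)).comp ?_))
    have h1 := (volume_preserving_piFinSuccAbove (fun _ : Fin 3 => ℝ) 0).symm
    have h2 := (MeasurePreserving.id (volume : Measure ℝ)).prod (volume_preserving_finTwoArrow ℝ).symm
    convert! h1.comp h2 using 1
    ext x i
    fin_cases i <;> rfl
  refine ⟨_, hT, ?_, ?_⟩
  all_goals
    intro s w
    rw [dist_comm, dist_eq_norm]
  · have : (2⁻¹ : ℝ) • (p + q) + b.repr.symm (WithLp.toLp 2 ![s, w.1, w.2]) - p =
        b.repr.symm (WithLp.toLp 2 ![s - dist p q / 2, w.1, w.2]) := by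
      have e : (2⁻¹ : ℝ) • (p + q) - p = -(dist p q / 2) • b 0 := by
        rw [show -(dist p q / 2) • b 0 = (-2⁻¹ : ℝ) • (dist p q • b 0) by
          rw [smul_smul]; ring_nf, ← hb]
        module
      rw [add_sub_right_comm, e]
      simp only [← OrthonormalBasis.sum_repr_symm, Fin.sum_univ_three]
      simp
      module
    rw [this, LinearIsometryEquiv.norm_map, EuclideanSpace.norm_eq]
    simp [Fin.sum_univ_three]
  · have : (2⁻¹ : ℝ) • (p + q) + b.repr.symm (WithLp.toLp 2 ![s, w.1, w.2]) - q =
        b.repr.symm (WithLp.toLp 2 ![s + dist p q / 2, w.1, w.2]) := by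
      have e : (2⁻¹ : ℝ) • (p + q) - q = (dist p q / 2) • b 0 := by
        rw [show (dist p q / 2) • b 0 = (2⁻¹ : ℝ) • (dist p q • b 0) by
          rw [smul_smul]; ring_nf, ← hb]
        module
      rw [add_sub_right_comm, e]
      simp only [← OrthonormalBasis.sum_repr_symm, Fin.sum_univ_three]
      simp
      module
    rw [this, LinearIsometryEquiv.norm_map, EuclideanSpace.norm_eq]
    simp [Fin.sum_univ_three]

namespace IsHatProfile

variable {F F₁ F₂ : ℝ → ℝ} (h : IsHatProfile F F₁ F₂)
include h

/-- In coordinates about the midpoint, the larger of the two distances is `√((|s| + u)² + |w|²)`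
with `u = dist p q / 2`, and the decreasing density turns the minimum into its value there.
Integrating over the plane of `w` gives `-F₁ (2 (|s| + u))`, and over `s` gives `F (2 u)`. -/
lemma lintegral_min (p q : EuclideanSpace ℝ (Fin 3)) :
    ∫⁻ z, ENNReal.ofReal (min (hatDensity F₂ (dist p z)) (hatDensity F₂ (dist q z))) =
      ENNReal.ofReal (F (dist p q)) := by
  have hm := h.measurable_hatDensity
  obtain ⟨T, hT, hp, hq⟩ := exists_measurePreserving_bipolar p q
  set u := dist p q / 2 with hu
  have hu0 : 0 ≤ u := by positivity
  rw [← hT.lintegral_comp (by fun_prop), Measure.volume_eq_prod,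
    lintegral_prod _ (by have := hT.measurable; fun_prop)]
  rw [show dist p q = 2 * u by rw [hu]; ring, ← h.lintegral_line hu0]
  -- Null sets are removed because `|s| + u` can vanish when `p = q`, and because `hatDensity F₂` is
  -- monotone only away from its default value at `0`.
  have hs0 : ∀ᵐ s : ℝ, s ≠ 0 := by simp [ae_iff, measure_singleton]
  refine lintegral_congr_ae ?_
  filter_upwards [hs0] with s hs
  have hpos : 0 < |s| + u := by positivity
  rw [← h.lintegral_plane hpos]
  have hw0 : ∀ᵐ w : ℝ × ℝ, w ≠ 0 := by simp [ae_iff, measure_singleton]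
  refine lintegral_congr_ae ?_
  filter_upwards [hw0] with w hw
  have hw' : 0 < w.1 ^ 2 + w.2 ^ 2 := by
    by_contra! hle
    exact hw (Prod.ext (by simp; nlinarith [sq_nonneg w.1, sq_nonneg w.2])
      (by simp; nlinarith [sq_nonneg w.1, sq_nonneg w.2]))
  simp only [hp, hq]
  have hsq (a : ℝ) : √(a ^ 2 + w.1 ^ 2 + w.2 ^ 2) ∈ Ioi (0 : ℝ) :=
    Real.sqrt_pos.2 (by nlinarith [sq_nonneg a])
  congr 1
  rcases le_total 0 s with h0 | h0
  · rw [abs_of_nonneg h0]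
    exact min_eq_right (h.hatDensity_antitoneOn (hsq _) (hsq _)
      (Real.sqrt_le_sqrt (by nlinarith)))
  · rw [abs_of_nonpos h0, show (-s + u) ^ 2 = (s - u) ^ 2 by ring]
    exact min_eq_left (h.hatDensity_antitoneOn (hsq _) (hsq _)
      (Real.sqrt_le_sqrt (by nlinarith)))

omit h in
/-- The region under the graph of `z ↦ hatDensity F₂ (dist p z)`. -/
def _root_.hatRegion (F₂ : ℝ → ℝ) (p : EuclideanSpace ℝ (Fin 3)) :
    Set (EuclideanSpace ℝ (Fin 3) × ℝ) :=
  regionBetween (fun _ => 0) (fun z => hatDensity F₂ (dist p z)) univ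

lemma measurableSet_hatRegion (p : EuclideanSpace ℝ (Fin 3)) : MeasurableSet (hatRegion F₂ p) := by
  have hm := h.measurable_hatDensity
  exact measurableSet_regionBetween measurable_const (by fun_prop) MeasurableSet.univ

lemma volume_hatRegion_inter (p q : EuclideanSpace ℝ (Fin 3)) :
    volume (hatRegion F₂ p ∩ hatRegion F₂ q) = ENNReal.ofReal (F (dist p q)) := by
  have hm := h.measurable_hatDensity
  rw [← h.lintegral_min p q, ← setLIntegral_univ]
  have : hatRegion F₂ p ∩ hatRegion F₂ q = regionBetween (fun _ => 0)
      (fun z => min (hatDensity F₂ (dist p z)) (hatDensity F₂ (dist q z))) univ := by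
    ext ⟨z, y⟩
    simp only [hatRegion, regionBetween, mem_inter_iff, mem_ofPred_eq, mem_univ, true_and, mem_Ioo,
      lt_min_iff]
    tauto
  rw [this, Measure.volume_eq_prod, volume_regionBetween_eq_lintegral (by fun_prop) (by fun_prop)
    MeasurableSet.univ]
  simp

lemma volume_hatRegion_ne_top (p : EuclideanSpace ℝ (Fin 3)) : volume (hatRegion F₂ p) ≠ ⊤ := by
  rw [← inter_self (hatRegion F₂ p), h.volume_hatRegion_inter]
  exact ENNReal.ofReal_ne_top

lemma nonneg {r : ℝ} (hr : 0 ≤ r) : 0 ≤ F r := by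
  have hanti : AntitoneOn F (Ici 0) := by
    refine antitoneOn_of_deriv_nonpos (convex_Ici 0) ?_ ?_ ?_
    · intro s hs
      rcases (mem_Ici.1 hs).eq_or_lt with rfl | hs
      · exact h.continuousWithinAt_zero
      · exact (h.hasDerivAt s hs).continuousAt.continuousWithinAt
    · rw [interior_Ici]
      exact fun s hs => (h.hasDerivAt s hs).differentiableAt.differentiableWithinAt
    · rw [interior_Ici]
      intro s hs
      rw [(h.hasDerivAt s hs).deriv]
      exact h.deriv_nonpos s hs
  refine le_of_tendsto h.tendsto ?_
  filter_upwards [eventually_ge_atTop r] with s hs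
  exact hanti hr (hr.trans hs) hs

/-- The kernel `F (dist p q)` on `ℝ³` is the Gram kernel of a family of vectors in a Hilbert
space. -/
lemma exists_inner_eq : ∃ Γ : EuclideanSpace ℝ (Fin 3) →
    Lp ℂ 2 (volume : Measure (EuclideanSpace ℝ (Fin 3) × ℝ)),
    ∀ p q, inner ℂ (Γ p) (Γ q) = (F (dist p q) : ℂ) := by
  refine ⟨fun p => indicatorConstLp 2 (h.measurableSet_hatRegion p)
    (h.volume_hatRegion_ne_top p) 1, fun p q => ?_⟩
  rw [L2.inner_indicatorConstLp_one_indicatorConstLp_one (h.measurableSet_hatRegion p)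
    (h.measurableSet_hatRegion q) (h.volume_hatRegion_ne_top p) (h.volume_hatRegion_ne_top q),
    measureReal_def,
    h.volume_hatRegion_inter, ENNReal.toReal_ofReal (h.nonneg dist_nonneg)]
  rfl

end IsHatProfile

/-! ### The heat symbol: decay, integrability and the profile conditions. -/

/-- The radial profile `r ↦ exp (-t r ^ β / log (lam + r) ^ α)` of `logHeatSymbol`. -/
noncomputable def logHeatProfile (α β lam t r : ℝ) : ℝ :=
  Real.exp (-t * (r ^ β / Real.log (lam + r) ^ α))

/-- The derivative of `logHeatProfile`. -/
noncomputable def logHeatProfileDeriv (α β lam t r : ℝ) : ℝ :=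
  logHeatProfile α β lam t r * (-t * logPowDeriv β α lam r)

/-- The second derivative of `logHeatProfile`. -/
noncomputable def logHeatProfileDeriv₂ (α β lam t r : ℝ) : ℝ :=
  logHeatProfile α β lam t r *
    ((t * logPowDeriv β α lam r) ^ 2 + t * (r * logPowNegDeriv₂Div β α lam r))

section

variable {α β lam t : ℝ}

lemma continuous_logHeatSymbol (d : ℕ) (hβ : 0 < β) (hlam : 1 < lam) :
    Continuous (logHeatSymbol d α β lam t) := by
  have h1 (ξ : EuclideanSpace ℝ (Fin d)) : 0 < Real.log (lam + ‖ξ‖) :=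
    Real.log_pos (by linarith [norm_nonneg ξ])
  have h2 (ξ : EuclideanSpace ℝ (Fin d)) : lam + ‖ξ‖ ≠ 0 := by linarith [norm_nonneg ξ]
  refine Real.continuous_exp.comp (continuous_const.mul (Continuous.div ?_ ?_ ?_))
  · exact continuous_norm.rpow_const fun _ => Or.inr hβ.le
  · exact ((continuous_const.add continuous_norm).log h2).rpow_const fun ξ => Or.inl (h1 ξ).ne'
  · exact fun ξ => (Real.rpow_pos_of_pos (h1 ξ) α).ne'

lemma tendsto_rpow_div_log_rpow (γ : ℝ) (hβ : 0 < β) (hlam : 1 < lam) :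
    Tendsto (fun r => r ^ β / Real.log (lam + r) ^ γ) atTop atTop := by
  have h1 : (fun r => Real.log (lam + r) ^ γ) =o[atTop] fun r => (lam + r) ^ β :=
    (isLittleO_log_rpow_rpow_atTop γ hβ).comp_tendsto (tendsto_atTop_add_const_left _ lam tendsto_id)
  have h2 : (fun r : ℝ => (lam + r) ^ β) =O[atTop] fun r => r ^ β := by
    refine Asymptotics.IsBigO.of_bound (2 ^ β) ?_
    filter_upwards [eventually_ge_atTop lam] with r hr
    have hr0 : 0 ≤ r := by linarith
    rw [Real.norm_of_nonneg (Real.rpow_nonneg (by linarith) _),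
      Real.norm_of_nonneg (Real.rpow_nonneg hr0 _), ← Real.mul_rpow two_pos.le hr0]
    exact Real.rpow_le_rpow (by linarith) (by linarith) hβ.le
  have h3 := (h1.trans_isBigO h2).tendsto_div_nhds_zero
  have h4 : Tendsto (fun r => Real.log (lam + r) ^ γ / r ^ β) atTop (𝓝[>] 0) := by
    refine tendsto_nhdsWithin_iff.2 ⟨h3, ?_⟩
    filter_upwards [eventually_gt_atTop 0] with r hr
    exact div_pos (Real.rpow_pos_of_pos (Real.log_pos (by linarith)) _)
      (Real.rpow_pos_of_pos hr _)
  refine h4.inv_tendsto_nhdsGT_zero.congr fun r => ?_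
  simp

/-- Even after one more division by the logarithm the exponent is unbounded, so `t ψ` eventually
exceeds `k log (lam + r)`. -/
lemma eventually_logHeatProfile_le (α : ℝ) (hβ : 0 < β) (hlam : 1 < lam) (ht : 0 < t) (k : ℕ) :
    ∀ᶠ r in atTop, logHeatProfile α β lam t r ≤ ((1 + r) ^ k)⁻¹ := by
  filter_upwards [eventually_gt_atTop 0,
    (tendsto_rpow_div_log_rpow (α + 1) hβ hlam).eventually_ge_atTop (k / t)] with r hr h
  have hL : 0 < Real.log (lam + r) := Real.log_pos (by linarith)
  rw [Real.rpow_add_one hL.ne', div_le_iff₀ ht, ← div_div, div_mul_eq_mul_div, le_div_iff₀ hL] at h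
  have h1 : Real.log (1 + r) ≤ Real.log (lam + r) := Real.log_le_log (by linarith) (by linarith)
  calc logHeatProfile α β lam t r ≤ Real.exp (-(k * Real.log (1 + r))) := by
        rw [logHeatProfile, Real.exp_le_exp]
        have := mul_le_mul_of_nonneg_left h1 (Nat.cast_nonneg (α := ℝ) k)
        linarith
    _ = ((1 + r) ^ k)⁻¹ := by
        rw [Real.exp_neg, ← Real.log_pow, Real.exp_log (by positivity)]

lemma tendsto_logHeatProfile (α : ℝ) (hβ : 0 < β) (hlam : 1 < lam) (ht : 0 < t) :
    Tendsto (logHeatProfile α β lam t) atTop (𝓝 0) :=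
  tendsto_of_tendsto_of_tendsto_of_le_of_le' tendsto_const_nhds
    (tendsto_inv_atTop_zero.comp (tendsto_atTop_add_const_left _ 1 tendsto_id))
    (Eventually.of_forall fun _ => (Real.exp_pos _).le)
    ((eventually_logHeatProfile_le α hβ hlam ht 1).mono fun r hr => by simpa using hr)

lemma hasDerivAt_logHeatProfile (α β t : ℝ) {r : ℝ} (hr : 0 < r) (hlam : 1 < lam) :
    HasDerivAt (logHeatProfile α β lam t) (logHeatProfileDeriv α β lam t r) r :=
  ((hasDerivAt_logPow β α hr hlam).const_mul (-t)).exp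

lemma hasDerivAt_logHeatProfileDeriv (α β t : ℝ) {r : ℝ} (hr : 0 < r) (hlam : 1 < lam) :
    HasDerivAt (logHeatProfileDeriv α β lam t) (logHeatProfileDeriv₂ α β lam t r) r := by
  refine ((hasDerivAt_logHeatProfile α β t hr hlam).mul
    ((hasDerivAt_logPowDeriv β α hr hlam).const_mul (-t))).congr_deriv ?_
  simp only [logHeatProfileDeriv, logHeatProfileDeriv₂]
  ring

lemma isHatProfile_logHeatProfile (hα : 0 ≤ α) (ht : 0 < t) (hβ : 0 < β) (hβ' : β ≤ 1)
    (hlam : Real.exp ((3 + 2 * α) / β) ≤ lam) :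
    IsHatProfile (logHeatProfile α β lam t) (logHeatProfileDeriv α β lam t)
      (logHeatProfileDeriv₂ α β lam t) := by
  have h1 := one_lt_of_exp_le hα hβ hlam
  have hexp (r : ℝ) : 0 ≤ logHeatProfile α β lam t r := (Real.exp_pos _).le
  have hD (r : ℝ) (hr : r ∈ Ioi (0 : ℝ)) := logPowDeriv_nonneg hα hβ hlam hr
  have hC (r : ℝ) (hr : r ∈ Ioi (0 : ℝ)) := logPowNegDeriv₂Div_nonneg hα hβ hβ' hlam hr
  have hDanti := logPowDeriv_antitoneOn hα hβ hβ' hlam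
  have hnonpos (r : ℝ) (hr : r ∈ Ioi (0 : ℝ)) : logHeatProfileDeriv α β lam t r ≤ 0 :=
    mul_nonpos_of_nonneg_of_nonpos (hexp r) (by nlinarith [hD r hr])
  have hFanti : AntitoneOn (logHeatProfile α β lam t) (Ioi 0) :=
    antitoneOn_Ioi_of_hasDerivAt_nonpos (fun r hr => hasDerivAt_logHeatProfile α β t hr h1) hnonpos
  refine ⟨?_, fun r hr => hasDerivAt_logHeatProfile α β t hr h1,
    fun r hr => hasDerivAt_logHeatProfileDeriv α β t hr h1, hnonpos, ?_, ?_, ?_,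
    tendsto_logHeatProfile α hβ h1 ht, ?_⟩
  · have hL : 0 < Real.log (lam + 0) := Real.log_pos (by linarith)
    refine ContinuousAt.continuousWithinAt ?_
    refine Real.continuous_exp.continuousAt.comp (continuousAt_const.mul (ContinuousAt.div ?_ ?_ ?_))
    · exact continuousAt_id.rpow_const (Or.inr hβ.le)
    · exact ((continuousAt_const.add continuousAt_id).log (by simp; linarith)).rpow_const
        (Or.inl hL.ne')
    · exact (Real.rpow_pos_of_pos hL α).ne'
  · unfold logHeatProfileDeriv₂ logHeatProfile logPowDeriv logPowNegDeriv₂Div logPowFactor₂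
      logPowFactor logSlopeRate logSlope
    fun_prop
  · intro r hr
    have := mul_nonneg (le_of_lt (mem_Ioi.1 hr)) (hC r hr)
    exact mul_nonneg (hexp r) (by positivity)
  -- In this form `F'' / r` is built by sums and products from nonnegative decreasing functions.
  · have e : EqOn (fun r => logHeatProfile α β lam t r *
        (t ^ 2 * (logPowDeriv β α lam r * logPowDeriv β α lam r * r⁻¹) +
          t * logPowNegDeriv₂Div β α lam r)) (fun r => logHeatProfileDeriv₂ α β lam t r / r)
        (Ioi 0) := by
      intro r hr
      have : r ≠ 0 := (mem_Ioi.1 hr).ne'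
      simp only [logHeatProfileDeriv₂]
      field_simp
    refine AntitoneOn.congr ?_ e
    intro a ha b hb hab
    have ha0 : 0 < a := ha
    have hb0 : 0 < b := hb
    have d1 := hDanti ha hb hab
    have d2 := logPowNegDeriv₂Div_antitoneOn hα hβ hβ' hlam ha hb hab
    have d3 := hFanti ha hb hab
    have hDb := hD b hb
    have hDa := hD a ha
    have hCb := hC b hb
    have hFa := hexp a
    dsimp only
    gcongr
  -- Since `ψ'` is decreasing, `|F'| ≤ t ψ'(1) F` for `r ≥ 1`.
  · have : ∀ᶠ r in atTop, -(t * logPowDeriv β α lam 1 * logHeatProfile α β lam t r) ≤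
        logHeatProfileDeriv α β lam t r := by
      filter_upwards [eventually_ge_atTop 1] with r hr
      have hr0 : (0 : ℝ) < r := by linarith
      have := hDanti (mem_Ioi.2 one_pos) hr0 hr
      simp only [logHeatProfileDeriv]
      nlinarith [mul_le_mul_of_nonneg_left this (mul_nonneg ht.le (hexp r))]
    refine tendsto_of_tendsto_of_tendsto_of_le_of_le' ?_ tendsto_const_nhds this ?_
    · simpa using ((tendsto_logHeatProfile α hβ h1 ht).const_mul
        (t * logPowDeriv β α lam 1)).neg
    · filter_upwards [eventually_gt_atTop 0] with r hr using hnonpos r hr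

lemma integrable_logHeatSymbol (d : ℕ) (α : ℝ) (hβ : 0 < β) (hlam : 1 < lam) (ht : 0 < t) :
    Integrable (logHeatSymbol d α β lam t) := by
  refine (continuous_logHeatSymbol d hβ hlam).locallyIntegrable.integrable_of_isBigO_cocompact
    (g := fun x => (1 + ‖x‖) ^ (-((d + 1 : ℕ) : ℝ))) ?_ ?_
  · refine Asymptotics.IsBigO.of_bound 1 ?_
    filter_upwards [(tendsto_norm_cocompact_atTop (E := EuclideanSpace ℝ (Fin d))).eventually
      (eventually_logHeatProfile_le α hβ hlam ht (d + 1))] with x hx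
    rw [one_mul, Real.norm_of_nonneg (show 0 ≤ logHeatSymbol d α β lam t x from (Real.exp_pos _).le),
      Real.norm_of_nonneg (by positivity),
      Real.rpow_neg (by positivity), Real.rpow_natCast]
    exact hx
  · exact (integrable_one_add_norm (by simp)).integrableAtFilter _

end

/-! ### Gram kernels and the easy half of Bochner's theorem. -/

section Gram

variable {H : Type*} [NormedAddCommGroup H] [InnerProductSpace ℂ H]

lemma inner_self_nonneg_complex (v : H) : (0 : ℂ) ≤ inner ℂ v v := by
  rw [inner_self_eq_norm_sq_to_K]
  have h : (0 : ℂ) ≤ ((‖v‖ ^ 2 : ℝ) : ℂ) := Complex.zero_le_real.2 (sq_nonneg _)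
  rwa [Complex.ofReal_pow] at h

lemma isPositiveDefiniteFun_of_inner_eq {d : ℕ} {f : EuclideanSpace ℝ (Fin d) → ℂ}
    {Γ : EuclideanSpace ℝ (Fin d) → H} (hΓ : ∀ x y, inner ℂ (Γ y) (Γ x) = f (x - y)) :
    IsPositiveDefiniteFun f := by
  intro n x c
  have : ∑ j, ∑ k, f (x j - x k) * c j * (starRingEnd ℂ) (c k) =
      inner ℂ (∑ k, c k • Γ (x k)) (∑ j, c j • Γ (x j)) := by
    simp only [inner_sum, sum_inner, inner_smul_left, inner_smul_right, hΓ]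
    refine Finset.sum_congr rfl fun j _ => ?_
    rw [Finset.mul_sum]
    exact Finset.sum_congr rfl fun k _ => by ring
  rw [this]
  exact inner_self_nonneg_complex _

/-- Expanding `‖Γ x - Γ a‖²` leaves only values of `f`. Continuity makes the weighted `Γ` Bochner
integrable later. -/
lemma continuous_of_inner_eq {V : Type*} [NormedAddCommGroup V] {f : V → ℂ} {Γ : V → H}
    (hΓ : ∀ x y, inner ℂ (Γ y) (Γ x) = f (x - y)) (hf : Continuous f) : Continuous Γ := by
  rw [continuous_iff_continuousAt]
  intro a
  have h (x : V) : ‖Γ x - Γ a‖ ^ 2 = (f 0 - f (x - a) - f (a - x) + f 0).re := by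
    rw [← @inner_self_eq_norm_sq ℂ, inner_sub_sub_self, hΓ, hΓ, hΓ, hΓ, sub_self, sub_self]
    simp only [RCLike.re_to_complex, Complex.add_re, Complex.sub_re]
    ring
  have ht : Tendsto (fun x => ‖Γ x - Γ a‖ ^ 2) (𝓝 a) (𝓝 0) := by
    have : Continuous fun x => (f 0 - f (x - a) - f (a - x) + f 0).re := by fun_prop
    simpa [h] using this.tendsto a
  have := ht.sqrt
  simp only [Real.sqrt_sq (norm_nonneg _), Real.sqrt_zero] at this
  exact tendsto_iff_norm_sub_tendsto_zero.2 this

variable [CompleteSpace H]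

/-- The double integral is the squared norm of `∫ v`. -/
lemma integral_integral_inner_nonneg {X : Type*} [MeasurableSpace X] {μ : Measure X} {v : X → H}
    (hv : Integrable v μ) : 0 ≤ ∫ y, ∫ x, inner ℂ (v y) (v x) ∂μ ∂μ := by
  simp only [integral_inner hv]
  have : ∫ y, inner ℂ (v y) (∫ x, v x ∂μ) ∂μ = inner ℂ (∫ x, v x ∂μ) (∫ x, v x ∂μ) := by
    rw [← inner_conj_symm, ← integral_inner hv, ← integral_conj]
    simp only [inner_conj_symm]
  rw [this]
  exact inner_self_nonneg_complex _

variable {V : Type*} [NormedAddCommGroup V] [InnerProductSpace ℝ V] [FiniteDimensional ℝ V]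
  [MeasurableSpace V] [BorelSpace V]

lemma integrable_rexp_neg_mul_sq_norm {b : ℝ} (hb : 0 < b) :
    Integrable fun v : V => Real.exp (-b * ‖v‖ ^ 2) := by
  refine (GaussianFourier.integrable_cexp_neg_mul_sq_norm_add (V := V) (b := b)
    (by simpa using hb) 0 0).re.congr (ae_of_all _ fun v => ?_)
  simp only [zero_mul, add_zero, RCLike.re_to_complex]
  rw [show -(b : ℂ) * (‖v‖ : ℂ) ^ 2 = ((-b * ‖v‖ ^ 2 : ℝ) : ℂ) by push_cast; ring,
    Complex.exp_ofReal_re]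

omit [CompleteSpace H] in
lemma integrable_gaussian_smul {b : ℝ} (hb : 0 < b) {g : V → H} (hg : Continuous g) {C : ℝ}
    (hC : ∀ x, ‖g x‖ ≤ C) : Integrable fun v : V => Complex.exp (-b * ‖v‖ ^ 2) • g v := by
  have h := GaussianFourier.integrable_cexp_neg_mul_sq_norm_add (V := V) (b := b)
    (by simpa using hb) 0 0
  simp only [zero_mul, add_zero] at h
  exact h.smul_bdd C hg.aestronglyMeasurable (ae_of_all _ hC)

/-- For `v x = exp (-2 b ‖x‖²) χ x Γ x`, the parallelogram law factors `⟪v y, v x⟫` as `G (x - y) E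
(x + y)`. After `u = x - y`, integrating out `y` leaves a positive constant times `∫ G`. -/
lemma integral_gaussian_mul_nonneg {f : V → ℂ} {Γ : V → H}
    (hΓ : ∀ x y, inner ℂ (Γ y) (Γ x) = f (x - y)) (hf : Continuous f) (hfi : Integrable f)
    {b : ℝ} (hb : 0 < b) (w : V) :
    0 ≤ ∫ u, Complex.exp (-b * ‖u‖ ^ 2) * (Complex.exp (Complex.I * (inner ℝ u w : ℝ)) * f u) := by
  have hΓc := continuous_of_inner_eq hΓ hf
  have hb2 : 0 < 2 * b := by positivity
  set χ : V → ℂ := fun u => Complex.exp (Complex.I * (inner ℝ u w : ℝ)) with hχ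
  have hχn (u : V) : ‖χ u‖ = 1 := by
    simp only [hχ]
    rw [mul_comm]
    exact Complex.norm_exp_ofReal_mul_I _
  have hχc : Continuous χ := by fun_prop
  set G : V → ℂ := fun u => Complex.exp (-b * ‖u‖ ^ 2) * (χ u * f u) with hG
  set E : V → ℝ := fun u => Real.exp (-b * ‖u‖ ^ 2) with hE
  have hE4 : Integrable fun y : V => Real.exp (-(4 * b) * ‖y‖ ^ 2) :=
    integrable_rexp_neg_mul_sq_norm (by positivity)
  -- As a function of `y` this is a translated Gaussian, so its integral does not depend on `u`.
  have hEs (u y : V) : E (u + (2 : ℝ) • y) = Real.exp (-(4 * b) * ‖y + (2⁻¹ : ℝ) • u‖ ^ 2) := by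
    have : u + (2 : ℝ) • y = (2 : ℝ) • (y + (2⁻¹ : ℝ) • u) := by module
    rw [hE, this]
    simp only [norm_smul]
    norm_num
    ring_nf
  have hEi (u : V) : Integrable fun y => E (u + (2 : ℝ) • y) := by
    simp only [hEs]
    exact hE4.comp_add_right _
  set c : ℝ := ∫ y : V, Real.exp (-(4 * b) * ‖y‖ ^ 2) with hc
  have hEc (u : V) : ∫ y, E (u + (2 : ℝ) • y) = c := by
    simp only [hEs]
    exact integral_add_right_eq_self (fun y : V => Real.exp (-(4 * b) * ‖y‖ ^ 2)) _
  have hc0 : 0 < c := by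
    rw [hc, GaussianFourier.integral_rexp_neg_mul_sq_norm (by positivity)]
    exact Real.rpow_pos_of_pos (div_pos Real.pi_pos (by positivity)) _
  have hGi : Integrable G := by
    refine (hfi.bdd_mul (c := 1) (f := fun u => Complex.exp (-b * ‖u‖ ^ 2) * χ u)
      (Continuous.aestronglyMeasurable (by fun_prop)) (ae_of_all _ fun u => ?_)).congr
      (ae_of_all _ fun u => by simp only [hG]; ring)
    rw [norm_mul, hχn, mul_one, show -(b : ℂ) * (‖u‖ : ℂ) ^ 2 = ((-b * ‖u‖ ^ 2 : ℝ) : ℂ) by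
      push_cast; ring, Complex.norm_exp_ofReal]
    exact Real.exp_le_one_iff.2 (by nlinarith [sq_nonneg ‖u‖])
  have hvi : Integrable fun x => Complex.exp (-(2 * b : ℝ) * ‖x‖ ^ 2) • χ x • Γ x := by
    refine integrable_gaussian_smul hb2 (hχc.smul hΓc) (C := √(f 0).re) fun x => ?_
    rw [norm_smul, hχn, one_mul]
    refine Real.le_sqrt_of_sq_le ?_
    rw [← @inner_self_eq_norm_sq ℂ, hΓ, sub_self]
    rfl
  have key (x y : V) : inner ℂ (Complex.exp (-(2 * b : ℝ) * ‖y‖ ^ 2) • χ y • Γ y)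
      (Complex.exp (-(2 * b : ℝ) * ‖x‖ ^ 2) • χ x • Γ x) = G (x - y) * (E (x + y) : ℂ) := by
    simp only [inner_smul_left, inner_smul_right, hΓ, hG, hE, hχ, ← Complex.exp_conj, map_mul,
      map_neg, Complex.conj_I, Complex.conj_ofReal, map_pow, Complex.ofReal_exp]
    have hp : ‖x - y‖ ^ 2 + ‖x + y‖ ^ 2 = 2 * ‖x‖ ^ 2 + 2 * ‖y‖ ^ 2 := by
      have := parallelogram_law_with_norm ℝ x y
      nlinarith
    have hp' : (‖x - y‖ : ℂ) ^ 2 + (‖x + y‖ : ℂ) ^ 2 = 2 * (‖x‖ : ℂ) ^ 2 + 2 * (‖y‖ : ℂ) ^ 2 := by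
      exact_mod_cast hp
    have : ∀ z a₁ a₂ a₃ a₄ b₁ b₂ b₃ : ℂ, a₁ + a₂ + a₃ + a₄ = b₁ + b₂ + b₃ →
        Complex.exp a₁ * (Complex.exp a₂ * (Complex.exp a₃ * (Complex.exp a₄ * z))) =
          Complex.exp b₁ * (Complex.exp b₂ * z) * Complex.exp b₃ := by
      intro z a₁ a₂ a₃ a₄ b₁ b₂ b₃ h
      have h' := congrArg Complex.exp h
      simp only [Complex.exp_add] at h'
      linear_combination z * h'
    refine this _ _ _ _ _ _ _ _ ?_
    rw [inner_sub_left]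
    push_cast
    linear_combination (b : ℂ) * hp'
  have h0 := integral_integral_inner_nonneg hvi
  simp only [key] at h0
  have e1 (y : V) : ∫ x, G (x - y) * (E (x + y) : ℂ) = ∫ u, G u * (E (u + (2 : ℝ) • y) : ℂ) := by
    rw [← integral_sub_right_eq_self (fun u => G u * (E (u + (2 : ℝ) • y) : ℂ)) y]
    refine integral_congr_ae (ae_of_all _ fun x => ?_)
    simp only [show x - y + (2 : ℝ) • y = x + y by module]
  have hprod : Integrable (Function.uncurry fun y u => G u * (E (u + (2 : ℝ) • y) : ℂ))
      (volume.prod volume) := by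
    have hm : AEStronglyMeasurable (Function.uncurry fun y u => G u * (E (u + (2 : ℝ) • y) : ℂ))
        (volume.prod volume) := by
      refine Continuous.aestronglyMeasurable ?_
      simp only [Function.uncurry_def, hG, hE]
      fun_prop
    rw [integrable_prod_iff' hm]
    refine ⟨ae_of_all _ fun u => ((hEi u).ofReal).const_mul (G u), ?_⟩
    have (u : V) : ∫ y, ‖G u * (E (u + (2 : ℝ) • y) : ℂ)‖ = ‖G u‖ * c := by
      simp only [norm_mul, Complex.norm_real, Real.norm_of_nonneg (show 0 ≤ E _ from
        (Real.exp_pos _).le)]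
      rw [integral_const_mul, hEc]
    simp only [Function.uncurry_apply_pair, this]
    exact hGi.norm.mul_const c
  simp only [e1] at h0
  rw [integral_integral_swap hprod] at h0
  simp only [integral_const_mul, integral_complex_ofReal, hEc] at h0
  rw [integral_mul_const] at h0
  have h1 : (0 : ℂ) ≤ ((c⁻¹ : ℝ) : ℂ) := by
    rw [Complex.zero_le_real]; positivity
  have := mul_nonneg h0 h1
  rwa [mul_assoc, ← Complex.ofReal_mul, mul_inv_cancel₀ hc0.ne', Complex.ofReal_one, mul_one]
    at this

/-- The easy direction of Bochner's theorem for an integrable Gram kernel. -/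
lemma fourier_nonneg_of_inner_eq {f : V → ℂ} {Γ : V → H}
    (hΓ : ∀ x y, inner ℂ (Γ y) (Γ x) = f (x - y)) (hf : Continuous f) (hfi : Integrable f)
    (w : V) : 0 ≤ 𝓕 f w := by
  have hi : Integrable fun u => Complex.exp (Complex.I * (inner ℝ u ((-2 * Real.pi) • w) : ℝ)) * f u := by
    refine hfi.bdd_mul (c := 1) (Continuous.aestronglyMeasurable (by fun_prop))
      (ae_of_all _ fun u => ?_)
    rw [mul_comm, Complex.norm_exp_ofReal_mul_I]
  have ht := Real.tendsto_integral_cexp_sq_smul hi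
  have : 𝓕 f w = ∫ u, Complex.exp (Complex.I * (inner ℝ u ((-2 * Real.pi) • w) : ℝ)) * f u := by
    rw [Real.fourier_eq']
    refine integral_congr_ae (ae_of_all _ fun u => ?_)
    simp only [inner_smul_right, smul_eq_mul]
    rw [mul_comm Complex.I]
  rw [this]
  -- The Gaussian regularisation with `b = 1 / c` is removed by letting `c` tend to infinity.
  refine ge_of_tendsto ht ?_
  filter_upwards [eventually_gt_atTop 0] with c hc
  simpa using integral_gaussian_mul_nonneg hΓ hf hfi (inv_pos.2 hc) ((-2 * Real.pi) • w)

omit [CompleteSpace H] in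
lemma continuous_fourier {f : V → ℂ} (hf : Integrable f) : Continuous (𝓕 f) :=
  VectorFourier.fourierIntegral_continuous Real.continuous_fourierChar continuous_inner hf

/-- A continuous integrable function with nonnegative Fourier transform has an integrable Fourier
transform. -/
lemma integrable_fourier_of_nonneg {f : V → ℂ} (hf : Continuous f) (hfi : Integrable f)
    (h0 : ∀ w, 0 ≤ 𝓕 f w) : Integrable (𝓕 f) := by
  have hbdd (w : V) : ‖𝓕 f w‖ ≤ ∫ v, ‖f v‖ :=
    VectorFourier.norm_fourierIntegral_le_integral_norm _ _ _ _ _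
  have hGi {c : ℝ} (hc : 0 < c) :
      Integrable fun w : V => Complex.exp (-(c⁻¹ : ℝ) * ‖w‖ ^ 2) • 𝓕 f w :=
    integrable_gaussian_smul (inv_pos.2 hc) (continuous_fourier hfi) hbdd
  have hlim : Tendsto (fun c : ℝ => ∫ w : V, Complex.exp (-(c⁻¹ : ℝ) * ‖w‖ ^ 2) • 𝓕 f w) atTop
      (𝓝 (f 0)) := by
    refine (Real.tendsto_integral_gaussian_smul' hfi (v := 0) hf.continuousAt).congr' ?_
    filter_upwards [eventually_gt_atTop 0] with c hc
    have J : Integrable fun w : V => Complex.exp (-(c⁻¹ : ℝ) * ‖w‖ ^ 2) := by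
      simpa using GaussianFourier.integrable_cexp_neg_mul_sq_norm_add (V := V) (b := (c⁻¹ : ℝ))
        (by simpa using hc) 0 0
    -- The multiplication formula moves the transform onto the Gaussian, which becomes an
    -- approximate identity at `0`.
    have e := VectorFourier.integral_fourierIntegral_smul_eq_flip (L := innerₗ V)
      Real.continuous_fourierChar continuous_inner J hfi
    rw [flip_innerₗ] at e
    refine Eq.trans ?_ e
    refine integral_congr_ae (ae_of_all _ fun w => ?_)
    have g := fourier_gaussian_innerProductSpace (V := V) (b := (c⁻¹ : ℝ)) (by simpa using hc) w
    have g' : VectorFourier.fourierIntegral Real.fourierChar volume (innerₗ V)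
      (fun w : V => Complex.exp (-(c⁻¹ : ℝ) * ‖w‖ ^ 2)) w = _ := g
    simp only [g']
    congr 2
    · simp
    · simp
      ring_nf
  refine ⟨(continuous_fourier hfi).aestronglyMeasurable, ?_⟩
  have hn : Tendsto (fun n : ℕ => ((n : ℝ) + 1)) atTop atTop :=
    tendsto_atTop_add_const_right _ _ tendsto_natCast_atTop_atTop
  set G : ℕ → V → ℂ := fun n w => Complex.exp (-(((n : ℝ) + 1)⁻¹ : ℝ) * ‖w‖ ^ 2) • 𝓕 f w with hG
  have hGr (n : ℕ) (w : V) : 0 ≤ G n w := by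
    simp only [hG, smul_eq_mul]
    refine mul_nonneg ?_ (h0 w)
    rw [show -(((n : ℝ) + 1)⁻¹ : ℝ) * (‖w‖ : ℂ) ^ 2 = ((-((n : ℝ) + 1)⁻¹ * ‖w‖ ^ 2 : ℝ) : ℂ) by
      push_cast; ring, ← Complex.ofReal_exp, Complex.zero_le_real]
    exact (Real.exp_pos _).le
  have hGint (n : ℕ) : Integrable (G n) := hGi (by positivity)
  have hpt (w : V) : Tendsto (fun n => ‖G n w‖ₑ) atTop (𝓝 ‖𝓕 f w‖ₑ) := by
    refine Tendsto.enorm ?_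
    have : Tendsto (fun n : ℕ => (((n : ℝ) + 1)⁻¹ : ℝ)) atTop (𝓝 0) := tendsto_inv_atTop_zero.comp hn
    have h2 := (((Complex.continuous_ofReal.tendsto 0).comp this).neg.mul_const ((‖w‖ : ℂ) ^ 2)).cexp
    simpa [hG] using h2.mul_const (𝓕 f w)
  have hnorm (n : ℕ) : ∫⁻ w, ‖G n w‖ₑ = ENNReal.ofReal (∫ w, G n w).re := by
    rw [← ofReal_integral_norm_eq_lintegral_enorm (hGint n)]
    congr 1
    have := integral_re (hGint n)
    simp only [RCLike.re_to_complex] at this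
    rw [← this]
    refine integral_congr_ae (ae_of_all _ fun w => ?_)
    simpa using congrArg Complex.re (Complex.norm_of_nonneg' (hGr n w))
  have hlim' : Tendsto (fun n => ∫⁻ w, ‖G n w‖ₑ) atTop (𝓝 (ENNReal.ofReal (f 0).re)) := by
    simp only [hnorm]
    exact (ENNReal.continuous_ofReal.tendsto _).comp
      ((Complex.continuous_re.tendsto _).comp (hlim.comp hn))
  -- Fatou's lemma: by nonnegativity the `L¹` norms of the damped transforms are their integrals,
  -- which converge to `f 0`.
  calc ∫⁻ w, ‖𝓕 f w‖ₑ = ∫⁻ w, liminf (fun n => ‖G n w‖ₑ) atTop :=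
        lintegral_congr fun w => (hpt w).liminf_eq.symm
    _ ≤ liminf (fun n => ∫⁻ w, ‖G n w‖ₑ) atTop := by
        refine lintegral_liminf_le fun n => ?_
        have := continuous_fourier hfi
        refine Continuous.measurable ?_
        simp only [hG]
        fun_prop
    _ = ENNReal.ofReal (f 0).re := hlim'.liminf_eq
    _ < ⊤ := ENNReal.ofReal_lt_top

end Gram

/-- The restriction on the dimension is used here: a Gram representation on `ℝ³` pulls back along an
isometry. -/
lemma exists_isometry_euclideanSpace_three {d : ℕ} (hd : d = 1 ∨ d = 2 ∨ d = 3) :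
    ∃ ι : EuclideanSpace ℝ (Fin d) → EuclideanSpace ℝ (Fin 3), Isometry ι := by
  rcases hd with rfl | rfl | rfl
  · refine ⟨fun x => !₂[x 0, 0, 0], Isometry.of_dist_eq fun x y => ?_⟩
    simp [EuclideanSpace.dist_eq, Fin.sum_univ_three]
  · refine ⟨fun x => !₂[x 0, x 1, 0], Isometry.of_dist_eq fun x y => ?_⟩
    simp [EuclideanSpace.dist_eq, Fin.sum_univ_three]
  · exact ⟨id, isometry_id⟩

/-! ### Fourier normalisations and the final assembly. -/

section Kernel

variable {d : ℕ} {α β lam t : ℝ}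

lemma logHeatKernel_eq_fourierInv (x : EuclideanSpace ℝ (Fin d)) :
    logHeatKernel d α β lam t x = ((2 * Real.pi : ℝ) : ℂ)⁻¹ ^ d *
      𝓕⁻ (fun ξ => (logHeatSymbol d α β lam t ξ : ℂ)) ((2 * Real.pi)⁻¹ • x) := by
  rw [logHeatKernel, Real.fourierInv_eq']
  congr 1
  refine integral_congr_ae (ae_of_all _ fun ξ => ?_)
  have := Real.pi_pos.ne'
  simp only [inner_smul_right, smul_eq_mul, real_inner_comm x ξ]
  rw [mul_comm, ← mul_assoc (2 * Real.pi), mul_inv_cancel₀ (by positivity), one_mul,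
    mul_comm Complex.I]

lemma fourierTransform_logHeatKernel_eq (ξ : EuclideanSpace ℝ (Fin d)) :
    fourierTransform (logHeatKernel d α β lam t) ξ =
      𝓕 (𝓕⁻ (fun ξ => (logHeatSymbol d α β lam t ξ : ℂ))) ξ := by
  have hpi : (0 : ℝ) < 2 * Real.pi := by positivity
  set f : EuclideanSpace ℝ (Fin d) → ℂ := fun ξ => (logHeatSymbol d α β lam t ξ : ℂ) with hf
  set g : EuclideanSpace ℝ (Fin d) → ℂ := fun w =>
    Complex.exp (((-2 * Real.pi * inner ℝ w ξ : ℝ) : ℂ) * Complex.I) • 𝓕⁻ f w with hg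
  have h1 := Measure.integral_comp_smul volume g (2 * Real.pi)⁻¹
  have h2 : fourierTransform (logHeatKernel d α β lam t) ξ =
      ∫ x, ((2 * Real.pi : ℝ) : ℂ)⁻¹ ^ d * g ((2 * Real.pi)⁻¹ • x) := by
    rw [fourierTransform]
    refine integral_congr_ae (ae_of_all _ fun x => ?_)
    simp only [logHeatKernel_eq_fourierInv, hg, inner_smul_left, smul_eq_mul, ← hf]
    rw [show ((-2 * Real.pi * ((starRingEnd ℝ) (2 * Real.pi)⁻¹ * inner ℝ x ξ) : ℝ) : ℂ) *
      Complex.I = -Complex.I * (inner ℝ x ξ : ℝ) by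
        rw [conj_trivial, show -2 * Real.pi * ((2 * Real.pi)⁻¹ * inner ℝ x ξ) = -inner ℝ x ξ by
          field_simp]
        push_cast
        ring]
    ring
  -- The Jacobian `(2 π) ^ d` of the dilation cancels the prefactor of the kernel.
  rw [h2, integral_const_mul, h1, Real.fourier_eq', finrank_euclideanSpace_fin, abs_of_pos
    (by positivity), Complex.real_smul, ← mul_assoc]
  push_cast
  rw [← inv_pow, ← mul_pow, inv_inv, inv_mul_cancel₀ (by
    simp [Real.pi_ne_zero]), one_pow, one_mul]
  simp only [hg]
  push_cast
  rfl

end Kernel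

theorem mainTheorem6 (d : ℕ) (hd : d = 1 ∨ d = 2 ∨ d = 3) (α β lam t : ℝ)
    (hα : 0 ≤ α) (ht : 0 < t) (hβ : 0 < β) (hβ' : β ≤ 1)
    (hlam : Real.exp ((3 + 2 * α) / β) ≤ lam) :
    IsPositiveDefiniteFun (fun x => (logHeatSymbol d α β lam t x : ℂ)) ∧
    -- `K_t` is an element of `L¹ ∩ C₀` whose Fourier transform is the symbol
    MeasureTheory.Integrable (logHeatKernel d α β lam t) ∧
    Continuous (logHeatKernel d α β lam t) ∧
    Filter.Tendsto (logHeatKernel d α β lam t)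
      (Filter.cocompact (EuclideanSpace ℝ (Fin d))) (nhds 0) ∧
    (∀ ξ, fourierTransform (logHeatKernel d α β lam t) ξ = (logHeatSymbol d α β lam t ξ : ℂ)) ∧
    -- `K_t` is a probability density
    (∀ x, 0 ≤ logHeatKernel d α β lam t x) ∧
    MeasureTheory.eLpNorm (logHeatKernel d α β lam t) 1 MeasureTheory.volume = 1 ∧
    ∫ x, logHeatKernel d α β lam t x = 1 := by
  have h1 := one_lt_of_exp_le hα hβ hlam
  obtain ⟨Γ, hΓ⟩ := (isHatProfile_logHeatProfile hα ht hβ hβ' hlam).exists_inner_eq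
  obtain ⟨ι, hι⟩ := exists_isometry_euclideanSpace_three hd
  set f : EuclideanSpace ℝ (Fin d) → ℂ := fun ξ => (logHeatSymbol d α β lam t ξ : ℂ) with hf
  have hgram (x y : EuclideanSpace ℝ (Fin d)) : inner ℂ (Γ (ι y)) (Γ (ι x)) = f (x - y) := by
    rw [hΓ, hι.dist_eq, dist_comm, dist_eq_norm]
    rfl
  have hfc : Continuous f := Complex.continuous_ofReal.comp (continuous_logHeatSymbol d hβ h1)
  have hfi : Integrable f := (integrable_logHeatSymbol d α hβ h1 ht).ofReal
  have hF0 := fourier_nonneg_of_inner_eq (Γ := Γ ∘ ι) hgram hfc hfi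
  have hFi : Integrable (𝓕 f) := integrable_fourier_of_nonneg hfc hfi hF0
  have hneg : 𝓕⁻ f = fun w => 𝓕 f (-w) := funext fun w => Real.fourierInv_eq_fourier_neg f w
  have hK : logHeatKernel d α β lam t = fun x => ((2 * Real.pi : ℝ) : ℂ)⁻¹ ^ d *
      𝓕 f ((-(2 * Real.pi)⁻¹ : ℝ) • x) := by
    ext x
    rw [logHeatKernel_eq_fourierInv, ← hf, hneg, neg_smul]
  have hc : (-(2 * Real.pi)⁻¹ : ℝ) ≠ 0 := by
    have := Real.pi_pos
    exact neg_ne_zero.2 (by positivity)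
  have hFc : Continuous (𝓕 f) := continuous_fourier hfi
  have hKi : Integrable (logHeatKernel d α β lam t) := by
    rw [hK]
    exact (hFi.comp_smul hc).const_mul _
  have hKF (ξ : EuclideanSpace ℝ (Fin d)) :
      fourierTransform (logHeatKernel d α β lam t) ξ = f ξ := by
    rw [fourierTransform_logHeatKernel_eq, ← hf, hfc.fourier_fourierInv_eq hfi hFi]
  have hK0 (x : EuclideanSpace ℝ (Fin d)) : 0 ≤ logHeatKernel d α β lam t x := by
    rw [hK]
    refine mul_nonneg (pow_nonneg ?_ d) (hF0 _)
    rw [← Complex.ofReal_inv, Complex.zero_le_real]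
    have := Real.pi_pos
    positivity
  have hK1 : ∫ x, logHeatKernel d α β lam t x = 1 := by
    -- The total mass is the transform at the origin, where the symbol is `1` because `0 ^ β = 0`.
    have h := hKF 0
    simpa [fourierTransform, hf, logHeatSymbol, Real.zero_rpow hβ.ne'] using h
  refine ⟨isPositiveDefiniteFun_of_inner_eq (Γ := Γ ∘ ι) hgram, hKi, ?_, ?_, hKF, hK0, ?_, hK1⟩
  · rw [hK]
    fun_prop
  · rw [hK]
    -- Riemann–Lebesgue lemma.
    have hF : Tendsto (𝓕 f) (cocompact _) (𝓝 0) := tendsto_integral_exp_inner_smul_cocompact f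
    have := (hF.comp (Homeomorph.smulOfNeZero (-(2 * Real.pi)⁻¹ : ℝ) hc
      (α := EuclideanSpace ℝ (Fin d))).isClosedEmbedding.tendsto_cocompact).const_mul
      (((2 * Real.pi : ℝ) : ℂ)⁻¹ ^ d)
    rw [mul_zero] at this
    exact this
  · have hn : ∫ x, ‖logHeatKernel d α β lam t x‖ = 1 := by
      have h : ((∫ x, ‖logHeatKernel d α β lam t x‖ : ℝ) : ℂ) = 1 := by
        rw [← hK1, ← integral_complex_ofReal]
        exact integral_congr_ae (ae_of_all _ fun x => Complex.norm_of_nonneg' (hK0 x))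
      exact_mod_cast h
    rw [eLpNorm_one_eq_lintegral_enorm, ← ofReal_integral_norm_eq_lintegral_enorm hKi, hn,
      ENNReal.ofReal_one]
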